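/- Let $Z=S^1\times[-1,1]$ with the measure $ds\,d\theta$ ($d\theta$ is arc length), and for $\theta\in S^1$ let $\theta^\perp$ be $\theta$ rotated counterclockwise by $\pi/2$. For $\mu\in\mathbb R$ the exponential Radon transform of $f:\mathbb R^2\to\mathbb R$ is $T_\mu f(\theta,s)=\int_{\mathbb R}e^{\mu t}f(s\theta+t\theta^\perp)\,dt$, $(\theta,s)\in Z$. For $\beta>1$, $L>0$ let $H(\beta,L)$ be the set of integrable functions $f:\mathbb R^2\to\mathbb R$ supported in the closed unit disc such that $\int_{\mathbb R^2}(1+\|\xi\|^2)^\beta|\tilde f(\xi)|^2\,d\xi\le L$, where $\tilde f(\xi)=\int f(x)e^{-i\xi\cdot x}\,dx$. For $n\ge1$ one observes $(\theta_i,s_i,Y_i)$, $1\le i\le n$, with $Y_i=T_\mu f(\theta_i,s_i)+\epsilon_i$, where the points $(\theta_i,s_i)$ are i.i.d. on $Z$ with law $\nu$, the errors $\epsilon_i$ are i.i.d. with law $G$ of mean zero and finite positive variance, and the errors are independent of the points. Write $E_f$ for the expectation under this model. Assume, with constants $I_0,v_0>0$ and $C_3$, (B1) $\displaystyle\int\ln\frac{dG(u)}{dG(u+v)}\,dG(u)\le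 I_0v^2$ for all $|v|\le v_0$ (the left side is the Kullback distance, equal to $+\infty$ when absolute continuity fails); (B2) for all $n$ and all measurable $g:Z\to[0,\infty]$, $\displaystyle E\Big[\sum_{i=1}^n g(\theta_i,s_i)\Big]\le C_3\,n\int_Z g(\theta,s)\,ds\,d\theta$. **Theorem.** Let $\beta>1$, $L>0$ and $\Psi_n=n^{-\beta/(2\beta+3)}$. Then there is a constant $c_1>0$, depending only on $\beta,L,\mu,I_0,v_0,C_3$, such that for all $\nu$ and $G$ as above $$\liminf_{n\to\infty}\ \inf_{\hat f_n}\ \sup_{f\in H(\beta,L)}\Psi_n^{-2}\,E_f\int_{\mathbb R^2}|\hat f_n(x)-f(x)|^2\,dx\ \ge\ c_1,$$ where the infimum is over all estimators, i.e. all jointly measurable real functions $\hat f_n$ of the data $(\theta_i,s_i,Y_i)_{i\le n}$ and of $x\in\mathbb R^2$. -/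

import Mathlib

open MeasureTheory ProbabilityTheory Filter
open scoped ENNReal

noncomputable section

namespace ExpRadon

/-- The Euclidean plane. -/
abbrev Plane : Type := EuclideanSpace ℝ (Fin 2)

/-- The unit circle. -/
abbrev UnitCircle : Type := Metric.sphere (0 : Plane) 1

/-- The observation cylinder `S¹ × [-1, 1]`, with points `(θ, s)`. -/
abbrev Cylinder : Type := UnitCircle × Set.Icc (-1 : ℝ) 1

/-- The measure `ds dθ` on the cylinder: arc length (total mass `2π`) times Lebesgue measure. -/
def cylinderMeasure : Measure Cylinder :=
  ((volume : Measure Plane).toSphere).prod ((volume : Measure ℝ).comap Subtype.val)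

/-- The unit vector `θ^⊥`, obtained from `θ` by a counterclockwise quarter turn. -/
def perp (θ : Plane) : Plane := !₂[-(θ 1), θ 0]

/-- The exponential Radon transform. The line `x ⬝ θ = s` is parametrized by arc length as
`x = s θ + t θ^⊥`, so that `x ⬝ θ^⊥ = t`. -/
def expRadon (μ : ℝ) (f : Plane → ℝ) (z : Cylinder) : ℝ :=
  ∫ t : ℝ, Real.exp (μ * t) * f ((z.2 : ℝ) • (z.1 : Plane) + t • perp z.1)

/-- The Fourier transform `∫ f(x) e^{-i ξ⬝x} dx`. -/
def fourierPlane (f : Plane → ℝ) (ξ : Plane) : ℂ :=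
  ∫ x : Plane, (f x : ℂ) * Complex.exp (-(Complex.I * ((inner ℝ ξ x : ℝ) : ℂ)))

/-- The class `H(β, L)`: functions supported in the closed unit disc whose Fourier transform
satisfies `∫ (1 + ‖ξ‖²)^β |f̃(ξ)|² dξ ≤ L`. -/
def sobolevClass (β L : ℝ) : Set (Plane → ℝ) :=
  {f | Measurable f ∧ Integrable f ∧ Function.support f ⊆ Metric.closedBall 0 1 ∧
    ∫⁻ ξ : Plane, ENNReal.ofReal ((1 + ‖ξ‖ ^ 2) ^ β * ‖fourierPlane f ξ‖ ^ 2)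
      ≤ ENNReal.ofReal L}

/-- The distribution of `n` i.i.d. design points with common law `ν`. -/
def designLaw (ν : Measure Cylinder) (n : ℕ) : Measure (Fin n → Cylinder) :=
  Measure.pi fun _ => ν

/-- The joint distribution of the data `((θ_i, s_i), Y_i)`, `i < n`, in the model
`Y_i = T_μ f (θ_i, s_i) + ε_i`, with design points i.i.d. of law `ν`, errors i.i.d. of law `G`,
and errors independent of the design. -/
def dataLaw (μ : ℝ) (ν : Measure Cylinder) (G : Measure ℝ) (f : Plane → ℝ) (n : ℕ) :
    Measure (Fin n → Cylinder × ℝ) :=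
  ((designLaw ν n).prod (Measure.pi fun _ : Fin n => G)).map
    fun p i => (p.1 i, expRadon μ f (p.1 i) + p.2 i)

/-- An estimator based on `n` observations: a function of the data and of `x`, jointly
measurable. -/
def Estimator (n : ℕ) : Type :=
  {e : (Fin n → Cylinder × ℝ) → Plane → ℝ // Measurable (Function.uncurry e)}

/-- The mean integrated squared error `E_f ∫ |f̂(x) - f(x)|² dx`, with values in `[0, ∞]`. -/
def mise (μ : ℝ) (ν : Measure Cylinder) (G : Measure ℝ) {n : ℕ} (e : Estimator n)
    (f : Plane → ℝ) : ℝ≥0∞ :=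
  ∫⁻ d, (∫⁻ x : Plane, ENNReal.ofReal ((e.1 d x - f x) ^ 2)) ∂(dataLaw μ ν G f n)

/-- The rate `Ψ_n = n^{-β/(2β+3)}`. -/
def rate (β : ℝ) (n : ℕ) : ℝ := (n : ℝ) ^ (-β / (2 * β + 3))

/-- The error law has mean zero and finite positive variance. -/
def IsCenteredNoise (G : Measure ℝ) : Prop :=
  MemLp (fun u : ℝ => u) 2 G ∧ ∫ u, u ∂G = 0 ∧ 0 < variance (fun u : ℝ => u) G

/-- The condition `∫ ln (dG(u) / dG(u+v)) dG(u) ≤ I₀ v²` for `|v| ≤ v₀`; here `dG(u+v)` is the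
image of `G` under `u ↦ u - v`, and the left side is the Kullback distance (which is `∞` without
absolute continuity). -/
def NoiseCondition (I₀ v₀ : ℝ) (G : Measure ℝ) : Prop :=
  ∀ v : ℝ, |v| ≤ v₀ →
    InformationTheory.klDiv G (G.map fun u => u - v) ≤ ENNReal.ofReal (I₀ * v ^ 2)

/-- The feasibility condition on the design: for all `n` and all measurable `g ≥ 0`,
`E ∑_{i ≤ n} g(θ_i, s_i) ≤ C₃ n ∫_Z g ds dθ`. -/
def FeasibleDesign (C₃ : ℝ) (ν : Measure Cylinder) : Prop :=
  ∀ (n : ℕ) (g : Cylinder → ℝ≥0∞), Measurable g →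
    ∫⁻ z, ∑ i, g (z i) ∂(designLaw ν n) ≤ ENNReal.ofReal C₃ * n * ∫⁻ z, g z ∂cylinderMeasure

end ExpRadon

end

namespace ExpRadon

/-! The bound comes from Assouad's hypercube of small perturbations. Put about `h⁻²` disjoint bumps
of width `h` and height `a` in the unit disc, each switched on or off. The squared Sobolev norm of
such a sum is `O(h^(-2β) a²)` (`exists_sobolev_bound`), so `a = A h^β` with `A` small keeps every
vertex in the class.

Switching one bump changes the transform by at most `exp |μ| * a * h`, and only for lines that meet
the bump (`abs_expRadon_sub_le`). Those lines form a strip of measure `O(h)` in the cylinder. By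
(B1) and (B2) the expected Kullback distance of `n` observations is therefore `O(n a² h³)`, and `h =
n^(-1/(2β+3))` makes `n h^(2β+3) = 1`. Adjacent vertices thus stay statistically indistinguishable
(`quarter_le_testing_error`).

An estimator then loses a multiple of `a² h²` on each bump, on average over the vertices. The `h⁻²`
bumps add up to a multiple of `a²`, which is of order `h^(2β) = Ψ_n²` (`card_mul_le_iSup_mise`). -/

/-! ### Testing between product measures -/

theorem lintegral_pi_prod {ι : Type*} [Fintype ι] {X : ι → Type*} [∀ i, MeasurableSpace (X i)]
    (P : ∀ i, Measure (X i)) [∀ i, IsProbabilityMeasure (P i)] {r : ∀ i, X i → ℝ≥0∞}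
    (hr : ∀ i, Measurable (r i)) :
    ∫⁻ x, ∏ i, r i (x i) ∂(Measure.pi P) = ∏ i, ∫⁻ x, r i x ∂(P i) := by
  have hind : iIndepFun (fun i (x : ∀ i, X i) => r i (x i)) (Measure.pi P) :=
    iIndepFun_pi fun i => (hr i).aemeasurable
  rw [lintegral_prod_eq_prod_lintegral_of_indepFun _ _ hind
    fun i => (hr i).comp (measurable_pi_apply i)]
  refine Finset.prod_congr rfl fun i _ => ?_
  exact (measurePreserving_eval P i).lintegral_comp (hr i)

theorem pi_withDensity {ι : Type*} [Fintype ι] {X : ι → Type*} [∀ i, MeasurableSpace (X i)]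
    (P Q : ∀ i, Measure (X i)) [∀ i, IsProbabilityMeasure (P i)]
    [∀ i, IsProbabilityMeasure (Q i)] {r : ∀ i, X i → ℝ≥0∞}
    (hr : ∀ i, Measurable (r i)) (h : ∀ i, P i = (Q i).withDensity (r i)) :
    Measure.pi P = (Measure.pi Q).withDensity fun x => ∏ i, r i (x i) := by
  refine Measure.pi_eq fun s hs => ?_
  rw [withDensity_apply _ (MeasurableSet.univ_pi hs),
    ← lintegral_indicator (MeasurableSet.univ_pi hs)]
  have : ∀ x : ∀ i, X i, (Set.univ.pi s).indicator (fun x => ∏ i, r i (x i)) x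
      = ∏ i, (s i).indicator (r i) (x i) := by
    intro x
    by_cases hx : x ∈ Set.univ.pi s
    · rw [Set.indicator_of_mem hx]
      exact Finset.prod_congr rfl fun i _ => by rw [Set.indicator_of_mem (hx i trivial)]
    · rw [Set.indicator_of_notMem hx]
      simp only [Set.mem_pi, Set.mem_univ, true_imp_iff, not_forall] at hx
      obtain ⟨i, hi⟩ := hx
      exact (Finset.prod_eq_zero (Finset.mem_univ i) (Set.indicator_of_notMem hi _)).symm
  simp_rw [this]
  rw [lintegral_pi_prod Q fun i => (hr i).indicator (hs i)]
  refine Finset.prod_congr rfl fun i _ => ?_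
  rw [lintegral_indicator (hs i), h i, withDensity_apply _ (hs i)]

/-- Jensen's inequality for the Hellinger affinity, obtained from the tangent line of the
exponential at log-likelihood ratio `κ`. Affinities multiply over coordinates, so only the Kullback
distances of the single factors are needed. -/
theorem exp_neg_half_le_lintegral_rpow {X : Type*} [MeasurableSpace X] (P Q : Measure X)
    [IsProbabilityMeasure P] [IsProbabilityMeasure Q] {κ : ℝ} (hκ : 0 ≤ κ)
    (h : InformationTheory.klDiv P Q ≤ ENNReal.ofReal κ) :
    P ≪ Q ∧ ENNReal.ofReal (Real.exp (-κ / 2)) ≤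
      ∫⁻ x, ((P.rnDeriv Q x)⁻¹) ^ (1 / 2 : ℝ) ∂P := by
  have hne : InformationTheory.klDiv P Q ≠ ∞ := ne_top_of_le_ne_top ENNReal.ofReal_ne_top h
  obtain ⟨hac, hint⟩ := InformationTheory.klDiv_ne_top_iff.1 hne
  refine ⟨hac, ?_⟩
  have hkl : ∫ x, llr P Q x ∂P ≤ κ := by
    rw [← InformationTheory.toReal_klDiv_of_measure_eq hac (by simp)]
    exact ENNReal.toReal_le_of_le_ofReal hκ h
  set F : X → ℝ := fun x => Real.exp (-κ / 2) * (1 - (llr P Q x - κ) / 2) with hF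
  have hint' : Integrable (fun x => (llr P Q x - κ) / 2) P :=
    (hint.sub (integrable_const κ)).div_const 2
  have hFint : Integrable F P := ((integrable_const (1 : ℝ)).sub hint').const_mul _
  have h1 : Real.exp (-κ / 2) ≤ ∫ x, F x ∂P := by
    rw [hF, integral_const_mul, integral_sub (integrable_const _) hint', integral_div,
      integral_sub hint (integrable_const _)]
    simp only [integral_const, probReal_univ, one_smul]
    have := Real.exp_pos (-κ / 2)
    nlinarith
  have h2 : ENNReal.ofReal (∫ x, F x ∂P) ≤ ∫⁻ x, ENNReal.ofReal (F x) ∂P := by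
    rw [integral_eq_lintegral_pos_part_sub_lintegral_neg_part hFint]
    refine (ENNReal.ofReal_le_ofReal (sub_le_self _ ENNReal.toReal_nonneg)).trans ?_
    exact ENNReal.ofReal_toReal_le
  refine (ENNReal.ofReal_le_ofReal h1).trans (h2.trans (lintegral_mono_ae ?_))
  filter_upwards [P.rnDeriv_pos hac, hac.ae_le (P.rnDeriv_ne_top Q)] with x hx0 hxt
  have hr : 0 < (P.rnDeriv Q x).toReal := ENNReal.toReal_pos hx0.ne' hxt
  rw [← ENNReal.ofReal_toReal hxt, ← ENNReal.ofReal_inv_of_pos hr,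
    ENNReal.ofReal_rpow_of_pos (inv_pos.2 hr)]
  refine ENNReal.ofReal_le_ofReal ?_
  have h3 : ((P.rnDeriv Q x).toReal⁻¹) ^ (1 / 2 : ℝ)
      = Real.exp (-κ / 2) * Real.exp (-(llr P Q x - κ) / 2) := by
    rw [← Real.exp_add, Real.rpow_def_of_pos (inv_pos.2 hr), Real.log_inv, llr]
    congr 1; ring
  rw [h3, hF]
  refine mul_le_mul_of_nonneg_left ?_ (Real.exp_pos _).le
  have := Real.add_one_le_exp (-(llr P Q x - κ) / 2)
  linarith

/-- Cauchy–Schwarz for `√S = √(min 1 S) * √(max 1 S)`; the second factor is controlled by `max 1 S ≤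
1 + S`. -/
theorem lintegral_rpow_half_sq_le {X : Type*} [MeasurableSpace X] (P : Measure X)
    [IsProbabilityMeasure P] {S : X → ℝ≥0∞} (hS : Measurable S) (hS1 : ∫⁻ x, S x ∂P ≤ 1) :
    (∫⁻ x, S x ^ (1 / 2 : ℝ) ∂P) ^ 2 ≤ 2 * ∫⁻ x, min 1 (S x) ∂P := by
  have hCS := ENNReal.lintegral_mul_le_Lp_mul_Lq P (p := 2) (q := 2)
    (by constructor <;> norm_num)
    (f := fun x => min 1 (S x) ^ (1 / 2 : ℝ)) (g := fun x => max 1 (S x) ^ (1 / 2 : ℝ))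
    (by fun_prop) (by fun_prop)
  have hmul : ∀ x, ((fun x => min 1 (S x) ^ (1 / 2 : ℝ)) * fun x => max 1 (S x) ^ (1 / 2 : ℝ)) x
      = S x ^ (1 / 2 : ℝ) := by
    intro x
    rw [Pi.mul_apply, ← ENNReal.mul_rpow_of_nonneg _ _ (by norm_num), min_mul_max, one_mul]
  have hsq : ∀ a : ℝ≥0∞, (a ^ (1 / 2 : ℝ)) ^ (2 : ℝ) = a := fun a => by
    rw [← ENNReal.rpow_mul]; norm_num
  simp only [hmul, hsq] at hCS
  have hmax : ∫⁻ x, max 1 (S x) ∂P ≤ 2 := by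
    calc ∫⁻ x, max 1 (S x) ∂P ≤ ∫⁻ x, (1 + S x) ∂P :=
          lintegral_mono fun x => max_le le_self_add le_add_self
      _ = 1 + ∫⁻ x, S x ∂P := by rw [lintegral_add_left measurable_const]; simp
      _ ≤ 1 + 1 := by gcongr
      _ = 2 := by norm_num
  calc (∫⁻ x, S x ^ (1 / 2 : ℝ) ∂P) ^ 2
      ≤ ((∫⁻ x, min 1 (S x) ∂P) ^ (1 / 2 : ℝ) * (∫⁻ x, max 1 (S x) ∂P) ^ (1 / 2 : ℝ)) ^ 2 := by
        gcongr
    _ = (∫⁻ x, min 1 (S x) ∂P) * ∫⁻ x, max 1 (S x) ∂P := by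
        have hsq' : ∀ a : ℝ≥0∞, (a ^ (1 / 2 : ℝ)) ^ 2 = a := fun a => by
          rw [← ENNReal.rpow_two, hsq]
        rw [mul_pow, hsq', hsq']
    _ ≤ (∫⁻ x, min 1 (S x) ∂P) * 2 := by gcongr
    _ = 2 * ∫⁻ x, min 1 (S x) ∂P := mul_comm _ _

/-- A Bretagnolle–Huber inequality for product measures. -/
theorem exp_neg_sum_klDiv_le_testing {ι : Type*} [Fintype ι] {X : ι → Type*}
    [∀ i, MeasurableSpace (X i)] (P Q : ∀ i, Measure (X i)) [∀ i, IsProbabilityMeasure (P i)]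
    [∀ i, IsProbabilityMeasure (Q i)] {κ : ι → ℝ} (hκ : ∀ i, 0 ≤ κ i)
    (h : ∀ i, InformationTheory.klDiv (P i) (Q i) ≤ ENNReal.ofReal (κ i))
    {g k : (∀ i, X i) → ℝ≥0∞} (hg : Measurable g) (hk : Measurable k)
    (hgk : ∀ x, 1 ≤ g x + k x) :
    ENNReal.ofReal (Real.exp (-∑ i, κ i) / 2) ≤
      ∫⁻ x, g x ∂(Measure.pi P) + ∫⁻ x, k x ∂(Measure.pi Q) := by
  set r : ∀ i, X i → ℝ≥0∞ := fun i => (P i).rnDeriv (Q i) with hr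
  have hrm : ∀ i, Measurable (r i) := fun i => Measure.measurable_rnDeriv _ _
  have hac : ∀ i, P i ≪ Q i := fun i => (exp_neg_half_le_lintegral_rpow _ _ (hκ i) (h i)).1
  -- `S` plays the role of `dQ/dP`. Only `S dP ≤ dQ` is available, since `Q` may charge sets that
  -- are null for `P`.
  set S : (∀ i, X i) → ℝ≥0∞ := fun x => ∏ i, (r i (x i))⁻¹ with hS
  have hSm : Measurable S :=
    Finset.measurable_prod _ fun i _ => ((hrm i).comp (measurable_pi_apply i)).inv
  have hPQ : Measure.pi P = (Measure.pi Q).withDensity fun x => ∏ i, r i (x i) :=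
    pi_withDensity P Q hrm fun i => (Measure.withDensity_rnDeriv_eq _ _ (hac i)).symm
  have hle : ∀ f : (∀ i, X i) → ℝ≥0∞, Measurable f →
      ∫⁻ x, f x * S x ∂(Measure.pi P) ≤ ∫⁻ x, f x ∂(Measure.pi Q) := by
    intro f hf
    have hRm : Measurable fun x : ∀ i, X i => ∏ i, r i (x i) :=
      Finset.measurable_prod _ fun i _ => (hrm i).comp (measurable_pi_apply i)
    rw [hPQ]
    refine (lintegral_withDensity_eq_lintegral_mul _ hRm (hf.mul hSm)).trans_le ?_
    refine lintegral_mono fun x => ?_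
    have : (∏ i, r i (x i)) * S x ≤ 1 := by
      rw [hS, ← Finset.prod_mul_distrib]
      exact Finset.prod_le_one' fun i _ => ENNReal.mul_inv_le_one _
    calc (∏ i, r i (x i)) * (f x * S x) = f x * ((∏ i, r i (x i)) * S x) := by ring
      _ ≤ f x * 1 := by gcongr
      _ = f x := mul_one _
  have hS1 : ∫⁻ x, S x ∂(Measure.pi P) ≤ 1 := by
    simpa using hle (fun _ => 1) measurable_const
  have hroot : ENNReal.ofReal (Real.exp (-(∑ i, κ i) / 2)) ≤
      ∫⁻ x, S x ^ (1 / 2 : ℝ) ∂(Measure.pi P) := by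
    have : ∀ x, S x ^ (1 / 2 : ℝ) = ∏ i, ((r i (x i))⁻¹) ^ (1 / 2 : ℝ) := fun x =>
      (ENNReal.prod_rpow_of_nonneg (by norm_num)).symm
    simp_rw [this]
    rw [lintegral_pi_prod P (r := fun i y => ((r i y)⁻¹) ^ (1 / 2 : ℝ))
      fun i => (hrm i).inv.pow_const _]
    calc ENNReal.ofReal (Real.exp (-(∑ i, κ i) / 2))
        = ∏ i, ENNReal.ofReal (Real.exp (-κ i / 2)) := by
          rw [← ENNReal.ofReal_prod_of_nonneg fun i _ => (Real.exp_pos _).le, ← Real.exp_sum]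
          congr 2
          rw [← Finset.sum_div, Finset.sum_neg_distrib]
      _ ≤ _ := Finset.prod_le_prod' fun i _ =>
          (exp_neg_half_le_lintegral_rpow _ _ (hκ i) (h i)).2
  have hmin : ENNReal.ofReal (Real.exp (-∑ i, κ i) / 2) ≤ ∫⁻ x, min 1 (S x) ∂(Measure.pi P) := by
    have h2 := (pow_le_pow_left' hroot 2).trans (lintegral_rpow_half_sq_le _ hSm hS1)
    have hexp : Real.exp (-(∑ i, κ i) / 2) ^ 2 = Real.exp (-∑ i, κ i) := by
      rw [← Real.exp_nat_mul]
      congr 1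
      push_cast
      linarith
    rw [← ENNReal.ofReal_pow (Real.exp_pos _).le, hexp] at h2
    rw [ENNReal.ofReal_div_of_pos two_pos]
    refine ENNReal.div_le_of_le_mul' ?_
    rwa [ENNReal.ofReal_ofNat]
  calc _ ≤ ∫⁻ x, min 1 (S x) ∂(Measure.pi P) := hmin
    -- Pointwise `min 1 S ≤ (g + k) * min 1 S ≤ g + k * S`.
    _ ≤ ∫⁻ x, (g x + k x * S x) ∂(Measure.pi P) := by
        refine lintegral_mono fun x => ?_
        rcases le_total 1 (S x) with h1 | h1
        · refine (min_le_left _ _).trans ((hgk x).trans ?_)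
          gcongr
          exact le_mul_of_one_le_right' h1
        · refine (min_le_right _ _).trans ?_
          calc S x ≤ (g x + k x) * S x := le_mul_of_one_le_left' (hgk x)
            _ = g x * S x + k x * S x := add_mul _ _ _
            _ ≤ _ := by
              gcongr
              exact mul_le_of_le_one_right' h1
    _ = ∫⁻ x, g x ∂(Measure.pi P) + ∫⁻ x, k x * S x ∂(Measure.pi P) := lintegral_add_left hg _
    _ ≤ _ := by
        exact add_le_add_right (hle k hk) _

/-! ### The regression model conditionally on the design -/

theorem measurable_perp : Measurable perp := by
  unfold perp
  fun_prop

theorem measurable_line : Measurable fun p : Cylinder × ℝ =>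
    (p.1.2 : ℝ) • (p.1.1 : Plane) + p.2 • perp p.1.1 := by
  have := measurable_perp
  fun_prop

theorem measurable_expRadon (μ : ℝ) {f : Plane → ℝ} (hf : Measurable f) :
    Measurable (expRadon μ f) := by
  have h : Measurable fun p : Cylinder × ℝ =>
      Real.exp (μ * p.2) * f ((p.1.2 : ℝ) • (p.1.1 : Plane) + p.2 • perp p.1.1) :=
    (by fun_prop : Measurable fun p : Cylinder × ℝ => Real.exp (μ * p.2)).mul
      (hf.comp measurable_line)
  exact (h.stronglyMeasurable.integral_prod_right (ν := volume)).measurable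

theorem measurable_dataMap {T : Cylinder → ℝ} (hT : Measurable T) (n : ℕ) :
    Measurable fun (p : (Fin n → Cylinder) × (Fin n → ℝ)) (i : Fin n) =>
      (p.1 i, T (p.1 i) + p.2 i) := by
  fun_prop

theorem lintegral_dataLaw (μ : ℝ) (ν : Measure Cylinder) (G : Measure ℝ) [IsProbabilityMeasure ν]
    [IsProbabilityMeasure G] {f : Plane → ℝ} (hf : Measurable f) (n : ℕ)
    {g : (Fin n → Cylinder × ℝ) → ℝ≥0∞} (hg : Measurable g) :
    ∫⁻ d, g d ∂(dataLaw μ ν G f n) = ∫⁻ z, ∫⁻ u : Fin n → ℝ,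
      g (fun i => (z i, expRadon μ f (z i) + u i)) ∂(Measure.pi fun _ => G) ∂(designLaw ν n) := by
  have hm := measurable_dataMap (measurable_expRadon μ hf) n
  rw [dataLaw, lintegral_map hg hm]
  have : SFinite (designLaw ν n) := by unfold designLaw; infer_instance
  exact lintegral_prod _ (hg.comp hm).aemeasurable

/-- Given the design, the two data laws are products of shifted noise laws, and the product testing
bound gives `exp (-K) / 2`. Replacing this by `1 / 2 - K / 2` makes it linear in the conditional
Kullback bound `K`, so the feasibility condition can be integrated in. Since `E K ≤ 1 / 2`, there
remains `1 / 2 - 1 / 4`. -/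
theorem quarter_le_testing_error {I₀ v₀ C₃ : ℝ} (hI₀ : 0 < I₀) (μ : ℝ) (ν : Measure Cylinder)
    (G : Measure ℝ) [IsProbabilityMeasure ν] [IsProbabilityMeasure G]
    (hG : NoiseCondition I₀ v₀ G) (hν : FeasibleDesign C₃ ν) {f₁ f₂ : Plane → ℝ}
    (hf₁ : Measurable f₁) (hf₂ : Measurable f₂) {n : ℕ}
    (hv : ∀ z, |expRadon μ f₁ z - expRadon μ f₂ z| ≤ v₀)
    (hE : ENNReal.ofReal C₃ * n * ∫⁻ z, ENNReal.ofReal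
      (I₀ * (expRadon μ f₁ z - expRadon μ f₂ z) ^ 2) ∂cylinderMeasure ≤ ENNReal.ofReal (1 / 2))
    {g k : (Fin n → Cylinder × ℝ) → ℝ≥0∞} (hg : Measurable g) (hk : Measurable k)
    (hgk : ∀ d, 1 ≤ g d + k d) :
    ENNReal.ofReal (1 / 4) ≤
      ∫⁻ d, g d ∂(dataLaw μ ν G f₁ n) + ∫⁻ d, k d ∂(dataLaw μ ν G f₂ n) := by
  have hT₁ := measurable_expRadon μ hf₁
  have hT₂ := measurable_expRadon μ hf₂
  have : IsProbabilityMeasure (designLaw ν n) := by unfold designLaw; infer_instance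
  rw [lintegral_dataLaw μ ν G hf₁ n hg, lintegral_dataLaw μ ν G hf₂ n hk]
  set v : Cylinder → ℝ := fun z => expRadon μ f₁ z - expRadon μ f₂ z with hvdef
  have hvm : Measurable v := hT₁.sub hT₂
  have hpoint : ∀ z : Fin n → Cylinder, ENNReal.ofReal (1 / 2) ≤
      (∫⁻ u : Fin n → ℝ, g (fun i => (z i, expRadon μ f₁ (z i) + u i)) ∂(Measure.pi fun _ => G) +
      ∫⁻ u : Fin n → ℝ, k (fun i => (z i, expRadon μ f₂ (z i) + u i)) ∂(Measure.pi fun _ => G)) +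
      2⁻¹ * ∑ i, ENNReal.ofReal (I₀ * v (z i) ^ 2) := by
    intro z
    have hshift : ∀ i, Measurable fun u : ℝ => u - v (z i) := fun i => by fun_prop
    have : ∀ i, IsProbabilityMeasure (G.map fun u => u - v (z i)) := fun i =>
      Measure.isProbabilityMeasure_map (hshift i).aemeasurable
    have hmm : ∀ T : Cylinder → ℝ, Measurable fun (u : Fin n → ℝ) (i : Fin n) =>
        (z i, T (z i) + u i) := fun T => by fun_prop
    -- Both hypotheses use the data map of `f₁`: shifting the noise by `-v (z i)` turns it into the
    -- data of `f₂`, so only noise laws are compared.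
    have key := exp_neg_sum_klDiv_le_testing (fun _ : Fin n => G)
      (fun i => G.map fun u => u - v (z i)) (κ := fun i => I₀ * v (z i) ^ 2)
      (fun i => by positivity) (fun i => hG _ (hv _))
      (hg.comp (hmm (expRadon μ f₁))) (hk.comp (hmm (expRadon μ f₁))) (fun u => hgk _)
    rw [← Measure.pi_map_pi (fun i => (hshift i).aemeasurable),
      lintegral_map (hk.comp (hmm (expRadon μ f₁))) (by fun_prop)] at key
    have hrew : ∀ u : Fin n → ℝ, (fun i => (z i, expRadon μ f₁ (z i) + (u i - v (z i))))
        = fun i => (z i, expRadon μ f₂ (z i) + u i) := by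
      intro u; funext i; rw [hvdef]; congr 1; ring
    simp only [Function.comp_apply, hrew] at key
    have hlow : (1 / 2 : ℝ) ≤ Real.exp (-∑ i, I₀ * v (z i) ^ 2) / 2
        + 2⁻¹ * ∑ i, I₀ * v (z i) ^ 2 := by
      have := Real.add_one_le_exp (-∑ i, I₀ * v (z i) ^ 2)
      linarith
    have hnn : ∀ i, 0 ≤ I₀ * v (z i) ^ 2 := fun i => by positivity
    refine (ENNReal.ofReal_le_ofReal hlow).trans ?_
    rw [ENNReal.ofReal_add (by positivity)
      (mul_nonneg (by norm_num) (Finset.sum_nonneg fun i _ => hnn i)),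
      ENNReal.ofReal_mul (by norm_num), ENNReal.ofReal_sum_of_nonneg fun i _ => hnn i,
      ENNReal.ofReal_inv_of_pos two_pos, ENNReal.ofReal_ofNat]
    exact add_le_add_left key _
  have hgm : Measurable fun z : Fin n → Cylinder =>
      ∫⁻ u : Fin n → ℝ, g (fun i => (z i, expRadon μ f₁ (z i) + u i)) ∂(Measure.pi fun _ => G) :=
    (hg.comp (measurable_dataMap hT₁ n)).lintegral_prod_right'
  have hkm : Measurable fun z : Fin n → Cylinder =>
      ∫⁻ u : Fin n → ℝ, k (fun i => (z i, expRadon μ f₂ (z i) + u i)) ∂(Measure.pi fun _ => G) :=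
    (hk.comp (measurable_dataMap hT₂ n)).lintegral_prod_right'
  have hvv : Measurable fun z => ENNReal.ofReal (I₀ * v z ^ 2) := by fun_prop
  have hint := lintegral_mono (μ := designLaw ν n) hpoint
  rw [lintegral_add_right _ (by fun_prop), lintegral_add_left hgm,
    lintegral_const_mul _ (by fun_prop)] at hint
  simp only [lintegral_const, measure_univ, mul_one] at hint
  have hfe : 2⁻¹ * ∫⁻ z, ∑ i, ENNReal.ofReal (I₀ * v (z i) ^ 2) ∂(designLaw ν n)
      ≤ ENNReal.ofReal (1 / 4) := by
    calc _ ≤ 2⁻¹ * ENNReal.ofReal (1 / 2) := by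
          gcongr
          exact (hν n _ hvv).trans hE
      _ = ENNReal.ofReal (1 / 4) := by
          rw [← ENNReal.ofReal_ofNat, ← ENNReal.ofReal_inv_of_pos two_pos,
            ← ENNReal.ofReal_mul (by norm_num)]
          norm_num
  have h4 : ENNReal.ofReal (1 / 2) = ENNReal.ofReal (1 / 4) + ENNReal.ofReal (1 / 4) := by
    rw [← ENNReal.ofReal_add (by norm_num) (by norm_num)]; norm_num
  rw [h4] at hint
  exact (ENNReal.add_le_add_iff_right ENNReal.ofReal_ne_top).1
    (hint.trans (add_le_add_right hfe _))

/-! ### Sobolev norms of sums of bumps -/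

section Fourier

open FourierTransform Laplacian Topology
open scoped SchwartzMap ContDiff

theorem fourier_laplacian (f : 𝓢(Plane, ℂ)) (ξ : Plane) :
    𝓕 (Δ f) ξ = -(2 * Real.pi) ^ 2 * (‖ξ‖ : ℂ) ^ 2 * 𝓕 f ξ := by
  rw [SchwartzMap.laplacian_eq_fourierMultiplierCLM, FourierTransform.fourier_smul,
    SchwartzMap.fourierMultiplierCLM_apply, FourierTransform.fourier_fourierInv_eq,
    smul_apply,
    SchwartzMap.smulLeftCLM_apply_apply (by fun_prop)]
  simp
  ring

/-- The function `ψ` is `(1 - Δ)^p φ`. A differential operator is local, so the support does not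
grow, while on the Fourier side it is multiplication by a polynomial. -/
theorem exists_bessel_iterate (φ : 𝓢(Plane, ℂ)) {K : Set Plane} (hK : IsClosed K)
    (hφ : Function.support φ ⊆ K) (p : ℕ) :
    ∃ ψ : 𝓢(Plane, ℂ), Function.support ψ ⊆ K ∧
      ∀ ξ, 𝓕 ψ ξ = ((1 + (2 * Real.pi) ^ 2 * ‖ξ‖ ^ 2) ^ p : ℝ) * 𝓕 φ ξ := by
  induction p with
  | zero => exact ⟨φ, hφ, fun ξ => by simp⟩
  | succ p ih =>
    obtain ⟨ψ, hψ, hF⟩ := ih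
    refine ⟨ψ - Δ ψ, fun x hx => ?_, fun ξ => ?_⟩
    · by_contra hxK
      refine hx ?_
      have h0 : (ψ : Plane → ℂ) =ᶠ[𝓝 x] fun _ => (0 : ℂ) := by
        filter_upwards [hK.isOpen_compl.mem_nhds hxK] with y hy
        by_contra h
        exact hy (hψ h)
      have h1 := (InnerProductSpace.laplacian_congr_nhds h0).eq_of_nhds
      rw [sub_apply, SchwartzMap.laplacian_apply, h1, h0.eq_of_nhds]
      simp
    · have hsub : 𝓕 (ψ - Δ ψ) = 𝓕 ψ - 𝓕 (Δ ψ) := (fourierCLM ℂ 𝓢(Plane, ℂ)).map_sub ψ (Δ ψ)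
      rw [hsub, sub_apply, fourier_laplacian, hF]
      push_cast
      ring

/-- A sum of translates of a dilated profile. -/
noncomputable def bumpSum {ι E : Type*} [Fintype ι] [NormedAddCommGroup E] [NormedSpace ℝ E]
    (φ : Plane → E) (h : ℝ) (y : ι → Plane) (c : ι → ℝ) (x : Plane) : E :=
  ∑ i, c i • φ (h⁻¹ • (x - y i))

theorem fourier_comp_dilation (g : Plane → ℂ) {h : ℝ} (hh : 0 < h) (y ξ : Plane) :
    𝓕 (fun x => g (h⁻¹ • (x - y))) ξ
      = Complex.exp ((↑(-2 * Real.pi * inner ℝ y ξ) * Complex.I)) * (h ^ 2 * 𝓕 g (h • ξ)) := by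
  rw [Real.fourier_eq', Real.fourier_eq']
  have h1 := integral_sub_right_eq_self (μ := (volume : Measure Plane))
    (fun v => Complex.exp ((↑(-2 * Real.pi * inner ℝ (v + y) ξ) * Complex.I)) • g (h⁻¹ • v)) y
  simp only [sub_add_cancel] at h1
  rw [h1]
  have h2 := Measure.integral_comp_inv_smul (volume : Measure Plane)
    (fun v => Complex.exp ((↑(-2 * Real.pi * inner ℝ (h • v + y) ξ) * Complex.I)) • g v) h
  simp only [smul_inv_smul₀ hh.ne'] at h2
  rw [h2, finrank_euclideanSpace_fin, abs_of_pos (by positivity), Complex.real_smul,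
    ← integral_const_mul, ← integral_const_mul, ← integral_const_mul]
  refine integral_congr_ae (ae_of_all _ fun v => ?_)
  simp only [inner_add_left, real_inner_smul_left, real_inner_smul_right, smul_eq_mul]
  rw [mul_add, Complex.ofReal_add, add_mul, Complex.exp_add]
  push_cast
  ring

/-- The centres enter only through phases, and the profile only through the common factor `𝓕 g (h •
ξ)`. A Fourier multiplier applied to the profile thus becomes one for the whole sum, with symbol
rescaled by `h`. -/
theorem fourier_bumpSum {ι : Type*} [Fintype ι] {g : Plane → ℂ} (hg : Integrable g) {h : ℝ}
    (hh : 0 < h) (y : ι → Plane) (c : ι → ℝ) (ξ : Plane) :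
    𝓕 (bumpSum g h y c) ξ
      = (h ^ 2 * ∑ i, c i * Complex.exp ((↑(-2 * Real.pi * inner ℝ (y i) ξ) * Complex.I)))
        * 𝓕 g (h • ξ) := by
  have hint : ∀ i, Integrable fun x => g (h⁻¹ • (x - y i)) := fun i =>
    (hg.comp_smul (inv_ne_zero hh.ne')).comp_sub_right (y i)
  have h1 : 𝓕 (bumpSum g h y c) ξ = ∑ i, (c i : ℂ) * 𝓕 (fun x => g (h⁻¹ • (x - y i))) ξ := by
    simp only [Real.fourier_eq, bumpSum, Finset.smul_sum]
    rw [integral_finsetSum]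
    · refine Finset.sum_congr rfl fun i _ => ?_
      rw [← integral_const_mul]
      refine integral_congr_ae (ae_of_all _ fun v => ?_)
      simp only [Circle.smul_def, Complex.real_smul, smul_eq_mul]
      ring
    · intro i _
      exact (Real.fourierIntegral_convergent_iff ξ).2 ((hint i).smul (c i))
  rw [h1, Finset.mul_sum, Finset.sum_mul]
  refine Finset.sum_congr rfl fun i _ => ?_
  rw [fourier_comp_dilation g hh]
  ring

theorem fourierPlane_eq (f : Plane → ℝ) (ξ : Plane) :
    fourierPlane f ξ = 𝓕 (fun x => (f x : ℂ)) ((2 * Real.pi)⁻¹ • ξ) := by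
  rw [Real.fourier_eq', fourierPlane]
  refine integral_congr_ae (ae_of_all _ fun v => ?_)
  simp only [real_inner_smul_right, smul_eq_mul]
  rw [mul_comm]
  congr 2
  rw [real_inner_comm]
  have : (Real.pi : ℂ) ≠ 0 := by exact_mod_cast Real.pi_ne_zero
  push_cast
  field_simp

theorem lintegral_comp_smul {f : Plane → ℝ≥0∞} (hf : Measurable f) {r : ℝ} (hr : 0 < r) :
    ∫⁻ ξ, f (r • ξ) = ENNReal.ofReal (r ^ 2)⁻¹ * ∫⁻ ξ, f ξ := by
  have := Measure.map_addHaar_smul (volume : Measure Plane) hr.ne'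
  rw [finrank_euclideanSpace_fin, abs_of_pos (by positivity)] at this
  rw [← lintegral_map hf (measurable_const_smul r), this, lintegral_smul_measure, smul_eq_mul]

/-- A smooth bump function supported in the disc of radius `1 / 3`. -/
noncomputable def bump : ContDiffBump (0 : Plane) := ⟨1 / 6, 1 / 3, by norm_num, by norm_num⟩

theorem support_bump : Function.support bump ⊆ Metric.closedBall 0 (1 / 3) := by
  rw [bump.support_eq]
  exact Metric.ball_subset_closedBall

/-- Centres in the unit disc whose mutual distances are at least `h`. -/
structure IsGrid {ι : Type*} (h : ℝ) (y : ι → Plane) : Prop where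
  pos : 0 < h
  sep : ∀ i j, i ≠ j → h ≤ dist (y i) (y j)
  inside : ∀ i, ‖y i‖ + h ≤ 1

theorem dist_le_of_profile_ne_zero {E : Type*} [NormedAddCommGroup E] {φ : Plane → E} {h : ℝ}
    (hφ : Function.support φ ⊆ Metric.closedBall 0 (1 / 3))
    (hh : 0 < h) {z x : Plane} (hx : φ (h⁻¹ • (x - z)) ≠ 0) : dist x z ≤ h / 3 := by
  have := hφ hx
  rw [mem_closedBall_zero_iff, norm_smul, norm_inv, Real.norm_of_nonneg hh.le,
    inv_mul_le_iff₀ hh] at this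
  rw [dist_eq_norm]
  linarith

section

variable {ι E : Type*} [Fintype ι] [NormedAddCommGroup E] [NormedSpace ℝ E]
  {φ : Plane → E} {h : ℝ} {y : ι → Plane}

/-- Two active bumps at `x` would have centres at distance at most `2h / 3`, less than the
separation `h`. -/
theorem bumpSum_eq_of_dist_le (hφ : Function.support φ ⊆ Metric.closedBall 0 (1 / 3))
    (hy : IsGrid h y) (c : ι → ℝ) {i : ι} {x : Plane} (hx : dist x (y i) ≤ h / 3) :
    bumpSum φ h y c x = c i • φ (h⁻¹ • (x - y i)) := by
  refine Finset.sum_eq_single i (fun j _ hj => ?_) (by simp)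
  by_contra hne
  have h1 := dist_le_of_profile_ne_zero hφ hy.pos (right_ne_zero_of_smul hne)
  have h2 := hy.sep i j hj.symm
  have h3 := dist_triangle_left (y i) (y j) x
  linarith [hy.pos]

theorem bumpSum_eq_zero (hφ : Function.support φ ⊆ Metric.closedBall 0 (1 / 3))
    (hy : IsGrid h y) (c : ι → ℝ) {x : Plane} (hx : ∀ i, h / 3 < dist x (y i)) :
    bumpSum φ h y c x = 0 := by
  refine Finset.sum_eq_zero fun i _ => ?_
  by_contra hne
  exact (hx i).not_ge (dist_le_of_profile_ne_zero hφ hy.pos (right_ne_zero_of_smul hne))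

theorem support_bumpSum (hφ : Function.support φ ⊆ Metric.closedBall 0 (1 / 3))
    (hy : IsGrid h y) (c : ι → ℝ) :
    Function.support (bumpSum φ h y c) ⊆ Metric.closedBall 0 1 := by
  intro x hx
  by_contra hne
  refine hx (bumpSum_eq_zero hφ hy c fun i => ?_)
  rw [mem_closedBall_zero_iff, not_le] at hne
  have h1 := norm_sub_norm_le x (y i)
  rw [← dist_eq_norm] at h1
  linarith [hy.pos, hy.inside i]

theorem norm_bumpSum_le (hφ : Function.support φ ⊆ Metric.closedBall 0 (1 / 3)) {M : ℝ}
    (hM : ∀ x, ‖φ x‖ ≤ M) (hy : IsGrid h y) {c : ι → ℝ} {a : ℝ} (ha : 0 ≤ a)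
    (hc : ∀ i, |c i| ≤ a) (x : Plane) : ‖bumpSum φ h y c x‖ ≤ a * M := by
  have hM0 : 0 ≤ M := (norm_nonneg _).trans (hM 0)
  by_cases hx : ∃ i, dist x (y i) ≤ h / 3
  · obtain ⟨i, hi⟩ := hx
    rw [bumpSum_eq_of_dist_le hφ hy c hi, norm_smul, Real.norm_eq_abs]
    exact mul_le_mul (hc i) (hM _) (norm_nonneg _) ha
  · push Not at hx
    rw [bumpSum_eq_zero hφ hy c hx, norm_zero]
    positivity

theorem contDiff_bumpSum (hφ : ContDiff ℝ ∞ φ) (h : ℝ) (y : ι → Plane) (c : ι → ℝ) :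
    ContDiff ℝ ∞ (bumpSum φ h y c) := by
  unfold bumpSum
  fun_prop

theorem hasCompactSupport_bumpSum (hφ : Function.support φ ⊆ Metric.closedBall 0 (1 / 3))
    (hy : IsGrid h y) (c : ι → ℝ) : HasCompactSupport (bumpSum φ h y c) :=
  HasCompactSupport.of_support_subset_isCompact (isCompact_closedBall 0 1)
    (support_bumpSum hφ hy c)

end

/-- Replaces the fractional Sobolev weight by the squared symbol of the rescaled operator `(1 -
h²Δ)^p`, using `1 + t ≤ h⁻² (1 + h² t)` for `h ≤ 1`. -/
theorem one_add_rpow_le {β h t : ℝ} {p : ℕ} (hβ : 0 ≤ β) (hp : β ≤ 2 * p) (hh : 0 < h)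
    (hh1 : h ≤ 1) (ht : 0 ≤ t) :
    (1 + t) ^ β ≤ h ^ (-2 * β) * ((1 + h ^ 2 * t) ^ p) ^ 2 := by
  have h0 : 0 < 1 + h ^ 2 * t := by positivity
  have h2 : h ^ (-2 * β) = ((h ^ 2)⁻¹) ^ β := by
    rw [Real.rpow_mul hh.le, Real.rpow_neg hh.le, Real.rpow_two]
  calc (1 + t) ^ β ≤ ((h ^ 2)⁻¹ * (1 + h ^ 2 * t)) ^ β := by
        refine Real.rpow_le_rpow (by positivity) ?_ hβ
        rw [inv_mul_eq_div, le_div_iff₀ (by positivity)]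
        nlinarith [pow_le_one₀ (n := 2) hh.le hh1]
    _ = h ^ (-2 * β) * (1 + h ^ 2 * t) ^ β := by
        rw [Real.mul_rpow (by positivity) h0.le, h2]
    _ ≤ h ^ (-2 * β) * (1 + h ^ 2 * t) ^ (2 * p : ℝ) := by
        gcongr
        · linarith [mul_nonneg (sq_nonneg h) ht]
    _ = _ := by
        rw [← pow_mul, ← Real.rpow_natCast (1 + h ^ 2 * t), Nat.cast_mul, Nat.cast_ofNat,
          mul_comm (p : ℝ)]

theorem lintegral_norm_sq_fourier (f : 𝓢(Plane, ℂ)) :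
    ∫⁻ ξ, ENNReal.ofReal (‖𝓕 f ξ‖ ^ 2) = ENNReal.ofReal (∫ x, ‖f x‖ ^ 2) := by
  rw [← SchwartzMap.integral_norm_sq_fourier, ofReal_integral_eq_lintegral_ofReal]
  · exact ((𝓕 f).memLp 2).integrable_norm_pow (by norm_num)
  · exact ae_of_all _ fun _ => by positivity

theorem integral_norm_bumpSum_sq_le {ι : Type*} [Fintype ι] {ψ : Plane → ℂ}
    (hψ : Function.support ψ ⊆ Metric.closedBall 0 (1 / 3)) {M : ℝ} (hM : ∀ x, ‖ψ x‖ ≤ M)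
    {h : ℝ} {y : ι → Plane} (hy : IsGrid h y) {c : ι → ℝ} {a : ℝ} (ha : 0 ≤ a)
    (hc : ∀ i, |c i| ≤ a) :
    ∫ x, ‖bumpSum ψ h y c x‖ ^ 2
      ≤ volume.real (Metric.closedBall (0 : Plane) 1) * (a * M) ^ 2 := by
  have hz : ∀ x, x ∉ Metric.closedBall (0 : Plane) 1 → ‖bumpSum ψ h y c x‖ ^ 2 = 0 := by
    intro x hx
    have : bumpSum ψ h y c x = 0 := by
      by_contra hne
      exact hx (support_bumpSum hψ hy c hne)
    simp [this]
  rw [← setIntegral_eq_integral_of_forall_compl_eq_zero hz, mul_comm]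
  refine (Real.le_norm_self _).trans
    (norm_setIntegral_le_of_norm_le_const (isCompact_closedBall (0 : Plane) 1).measure_lt_top
      fun x _ => ?_)
  rw [Real.norm_of_nonneg (by positivity)]
  exact pow_le_pow_left₀ (norm_nonneg _) (norm_bumpSum_le hψ hM hy ha hc x) 2

theorem ofReal_bumpSum {ι : Type*} [Fintype ι] (φ : Plane → ℝ) (h : ℝ) (y : ι → Plane)
    (c : ι → ℝ) :
    (fun x => ((bumpSum φ h y c x : ℝ) : ℂ)) = bumpSum (fun x => (φ x : ℂ)) h y c := by
  funext x
  simp [bumpSum]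

/-- The weighted Fourier integral is dominated by the squared `L²` norm of the bump sum with profile
`ψ = (1 - Δ)^p bump`, through Plancherel. The pieces keep disjoint supports in the unit disc, so
this norm is at most the area times `(a M)²`, however many bumps there are. -/
theorem exists_sobolev_bound {β : ℝ} (hβ : 0 ≤ β) : ∃ C : ℝ, 0 < C ∧
    ∀ (ι : Type) [Fintype ι] (h a : ℝ) (y : ι → Plane) (c : ι → ℝ), IsGrid h y → h ≤ 1 →
      0 ≤ a → (∀ i, |c i| ≤ a) →
      ∫⁻ ξ : Plane, ENNReal.ofReal ((1 + ‖ξ‖ ^ 2) ^ β * ‖fourierPlane (bumpSum bump h y c) ξ‖ ^ 2)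
        ≤ ENNReal.ofReal (C * (h ^ (-2 * β) * a ^ 2)) := by
  have hsm : ContDiff ℝ ∞ fun x => (bump x : ℂ) := Complex.ofRealCLM.contDiff.comp bump.contDiff
  have hsupp : Function.support (fun x => (bump x : ℂ)) ⊆ Metric.closedBall 0 (1 / 3) := by
    intro x hx
    exact support_bump fun h0 => hx (by simp [h0])
  have hcs : HasCompactSupport fun x => (bump x : ℂ) :=
    HasCompactSupport.of_support_subset_isCompact (isCompact_closedBall 0 (1 / 3)) hsupp
  obtain ⟨p, hp⟩ := exists_nat_ge (β / 2)
  obtain ⟨ψ, hψs, hψF⟩ := exists_bessel_iterate (hcs.toSchwartzMap hsm)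
    Metric.isClosed_closedBall hsupp p
  obtain ⟨M, hM⟩ : ∃ M, ∀ x, ‖ψ x‖ ≤ M := ⟨_, ψ.toBoundedContinuousFunction.norm_coe_le_norm⟩
  set V := volume.real (Metric.closedBall (0 : Plane) 1)
  -- Jacobian of the change of Fourier normalization times area times squared supremum; the `+ 1`
  -- gives positivity without knowing `M ≠ 0`.
  refine ⟨(2 * Real.pi) ^ 2 * (V * M ^ 2) + 1, by positivity, ?_⟩
  intro ι _ h a y c hy hh1 ha hc
  have hh := hy.pos
  set Lψ : 𝓢(Plane, ℂ) := (hasCompactSupport_bumpSum hψs hy c).toSchwartzMap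
    (contDiff_bumpSum (ψ.smooth ⊤) h y c) with hLψ
  have hfour : ∀ ξ, 𝓕 Lψ ξ = ((1 + h ^ 2 * ((2 * Real.pi) ^ 2 * ‖ξ‖ ^ 2)) ^ p : ℝ) *
      𝓕 (fun x => ((bumpSum bump h y c x : ℝ) : ℂ)) ξ := by
    intro ξ
    have e1 : 𝓕 Lψ ξ = 𝓕 (bumpSum ψ h y c) ξ := rfl
    have e2 : 𝓕 ψ (h • ξ) = ((1 + (2 * Real.pi) ^ 2 * ‖h • ξ‖ ^ 2) ^ p : ℝ) *
      𝓕 (fun x => (bump x : ℂ)) (h • ξ) := hψF (h • ξ)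
    rw [SchwartzMap.fourier_coe] at e2
    have hbi : Integrable fun x => (bump x : ℂ) := (hcs.toSchwartzMap hsm).integrable
    rw [e1, ofReal_bumpSum, fourier_bumpSum ψ.integrable hh, fourier_bumpSum hbi hh, e2,
      norm_smul, Real.norm_of_nonneg hh.le]
    rw [mul_left_comm]
    congr 4
    ring
  have hmeas : Measurable fun ξ : Plane => ENNReal.ofReal ((1 + ‖(2 * Real.pi) • ξ‖ ^ 2) ^ β *
      ‖𝓕 (fun x => ((bumpSum bump h y c x : ℝ) : ℂ)) ξ‖ ^ 2) := by
    have : Measurable (𝓕 (fun x => ((bumpSum bump h y c x : ℝ) : ℂ))) := by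
      -- Dividing by the nowhere vanishing symbol expresses the transform by that of a Schwartz
      -- function, whence measurability.
      have hc' : (𝓕 (fun x => ((bumpSum bump h y c x : ℝ) : ℂ))) = fun ξ =>
          ((1 + h ^ 2 * ((2 * Real.pi) ^ 2 * ‖ξ‖ ^ 2)) ^ p : ℝ)⁻¹ * 𝓕 Lψ ξ := by
        funext ξ
        rw [hfour, ← mul_assoc, ← Complex.ofReal_mul, inv_mul_cancel₀,
          Complex.ofReal_one, one_mul]
        positivity
      rw [hc']
      have := (𝓕 Lψ).continuous.measurable
      fun_prop
    fun_prop
  have hpi : (0 : ℝ) < (2 * Real.pi)⁻¹ := by positivity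
  have hchange := lintegral_comp_smul hmeas hpi
  simp only [smul_inv_smul₀ (by positivity : 2 * Real.pi ≠ 0), ← fourierPlane_eq] at hchange
  rw [hchange]
  calc _ ≤ ENNReal.ofReal (((2 * Real.pi)⁻¹ ^ 2)⁻¹) *
        ∫⁻ ξ, ENNReal.ofReal (h ^ (-2 * β)) * ENNReal.ofReal (‖𝓕 Lψ ξ‖ ^ 2) := by
        gcongr with ξ
        rw [← ENNReal.ofReal_mul (by positivity)]
        refine ENNReal.ofReal_le_ofReal ?_
        rw [hfour, norm_mul, mul_pow, ← mul_assoc, Complex.norm_real,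
          Real.norm_of_nonneg (by positivity), norm_smul, Real.norm_of_nonneg (by positivity),
          mul_pow]
        gcongr
        exact one_add_rpow_le hβ (by linarith) hh hh1 (by positivity)
    _ = ENNReal.ofReal ((2 * Real.pi) ^ 2 * (h ^ (-2 * β) * ∫ x, ‖Lψ x‖ ^ 2)) := by
        rw [lintegral_const_mul' _ _ ENNReal.ofReal_ne_top, lintegral_norm_sq_fourier,
          ← ENNReal.ofReal_mul (by positivity), ← ENNReal.ofReal_mul (by positivity), inv_pow,
          inv_inv]
    _ ≤ _ := by
        refine ENNReal.ofReal_le_ofReal ?_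
        have hb : ∫ x, ‖Lψ x‖ ^ 2 ≤ V * (a * M) ^ 2 :=
          integral_norm_bumpSum_sq_le hψs hM hy ha hc
        have hpos : 0 ≤ h ^ (-2 * β) * a ^ 2 := by positivity
        calc _ ≤ (2 * Real.pi) ^ 2 * (h ^ (-2 * β) * (V * (a * M) ^ 2)) := by gcongr
          _ = (2 * Real.pi) ^ 2 * (V * M ^ 2) * (h ^ (-2 * β) * a ^ 2) := by ring
          _ ≤ _ := by linarith

theorem integrable_bumpSum {ι : Type*} [Fintype ι] {h : ℝ} {y : ι → Plane} (hy : IsGrid h y)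
    (c : ι → ℝ) : Integrable (bumpSum bump h y c) :=
  (contDiff_bumpSum bump.contDiff h y c).continuous.integrable_of_hasCompactSupport
    (hasCompactSupport_bumpSum support_bump hy c)

theorem measurable_bumpSum {ι : Type*} [Fintype ι] (h : ℝ) (y : ι → Plane)
    (c : ι → ℝ) : Measurable (bumpSum bump h y c) :=
  (contDiff_bumpSum bump.contDiff h y c).continuous.measurable

end Fourier

/-! ### Effect of one bump on the exponential Radon transform -/

/-- The point of the line with coordinates `z = (θ, s)` at arc length `t`. -/
noncomputable def linePoint (z : Cylinder) (t : ℝ) : Plane :=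
  (z.2 : ℝ) • (z.1 : Plane) + t • perp z.1

theorem inner_plane (x y : Plane) : inner ℝ x y = x 0 * y 0 + x 1 * y 1 := by
  simp [PiLp.inner_apply, Fin.sum_univ_two, mul_comm]

theorem sq_add_sq_circle (θ : UnitCircle) : (θ : Plane) 0 ^ 2 + (θ : Plane) 1 ^ 2 = 1 := by
  have h : ‖(θ : Plane)‖ = 1 := by simp
  have h2 := real_inner_self_eq_norm_sq (θ : Plane)
  rw [inner_plane, h] at h2
  linarith

theorem norm_perp (θ : UnitCircle) : ‖perp θ‖ = 1 := by
  have h2 := real_inner_self_eq_norm_sq (perp θ)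
  rw [inner_plane] at h2
  have h3 := sq_add_sq_circle θ
  have h4 : ‖perp (θ : Plane)‖ ^ 2 = 1 := by
    rw [← h2]
    simp [perp]
    linear_combination h3
  nlinarith [norm_nonneg (perp (θ : Plane))]

theorem inner_linePoint_perp (z : Cylinder) (t : ℝ) : inner ℝ (linePoint z t) (perp z.1) = t := by
  have h3 := sq_add_sq_circle z.1
  rw [inner_plane]
  simp [linePoint, perp]
  linear_combination t * h3

theorem inner_linePoint_dir (z : Cylinder) (t : ℝ) :
    inner ℝ (linePoint z t) (z.1 : Plane) = z.2 := by
  have h3 := sq_add_sq_circle z.1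
  rw [inner_plane]
  simp [linePoint, perp]
  linear_combination (z.2 : ℝ) * h3

theorem abs_sub_inner_perp_le (z : Cylinder) (t : ℝ) (w : Plane) :
    |t - inner ℝ w (perp z.1)| ≤ dist (linePoint z t) w := by
  nth_rw 1 [← inner_linePoint_perp z t]
  rw [← inner_sub_left, dist_eq_norm]
  simpa [norm_perp] using abs_real_inner_le_norm (linePoint z t - w) (perp z.1)

theorem abs_sub_inner_dir_le (z : Cylinder) (t : ℝ) (w : Plane) :
    |(z.2 : ℝ) - inner ℝ w (z.1 : Plane)| ≤ dist (linePoint z t) w := by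
  nth_rw 1 [← inner_linePoint_dir z t]
  rw [← inner_sub_left, dist_eq_norm]
  simpa using abs_real_inner_le_norm (linePoint z t - w) (z.1 : Plane)

theorem integrable_along_line (μ : ℝ) {f : Plane → ℝ} (hf : Continuous f)
    (hs : Function.support f ⊆ Metric.closedBall 0 1) (z : Cylinder) :
    Integrable fun t : ℝ => Real.exp (μ * t) * f (linePoint z t) := by
  have hc : Continuous (linePoint z) := by unfold linePoint; fun_prop
  refine Continuous.integrable_of_hasCompactSupport (by fun_prop)
    (HasCompactSupport.of_support_subset_isCompact (isCompact_Icc (a := (-1 : ℝ)) (b := 1)) ?_)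
  intro t ht
  have h1 := hs (right_ne_zero_of_mul ht)
  rw [Metric.mem_closedBall] at h1
  have h2 := abs_sub_inner_perp_le z t 0
  rw [inner_zero_left, sub_zero] at h2
  exact abs_le.1 (h2.trans h1)

/-- The distance from `w` to a point of the line is at least both coordinate differences in the
frame `θ, θ^⊥`. The first confines the effect to a strip in `s`; the second confines `t` to an
interval of length `2h / 3`. -/
theorem abs_expRadon_sub_le (μ : ℝ) {f₁ f₂ : Plane → ℝ} (hf₁ : Continuous f₁)
    (hf₂ : Continuous f₂) (hs₁ : Function.support f₁ ⊆ Metric.closedBall 0 1)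
    (hs₂ : Function.support f₂ ⊆ Metric.closedBall 0 1) {w : Plane} {a h : ℝ} (ha : 0 ≤ a)
    (hh : 0 < h) (hw : ‖w‖ + h ≤ 1) (hb : ∀ x, |f₁ x - f₂ x| ≤ a)
    (hd : ∀ x, h / 3 < dist x w → f₁ x = f₂ x) (z : Cylinder) :
    |expRadon μ f₁ z - expRadon μ f₂ z| ≤
      {z : Cylinder | |(z.2 : ℝ) - inner ℝ w (z.1 : Plane)| ≤ h / 3}.indicator
        (fun _ => Real.exp |μ| * a * h) z := by
  have e : expRadon μ f₁ z - expRadon μ f₂ z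
      = ∫ t : ℝ, Real.exp (μ * t) * (f₁ (linePoint z t) - f₂ (linePoint z t)) := by
    simp only [mul_sub]
    exact (integral_sub (integrable_along_line μ hf₁ hs₁ z)
      (integrable_along_line μ hf₂ hs₂ z)).symm
  rw [e]
  by_cases hz : |(z.2 : ℝ) - inner ℝ w (z.1 : Plane)| ≤ h / 3
  · rw [Set.indicator_of_mem (by exact hz)]
    set c : ℝ := inner ℝ w (perp z.1)
    have hc : |c| ≤ ‖w‖ := by simpa [norm_perp] using abs_real_inner_le_norm w (perp z.1)
    have hz0 : ∀ t, t ∉ Set.Icc (c - h / 3) (c + h / 3) →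
        Real.exp (μ * t) * (f₁ (linePoint z t) - f₂ (linePoint z t)) = 0 := by
      intro t ht
      rw [hd (linePoint z t) ?_, sub_self, mul_zero]
      refine lt_of_lt_of_le ?_ (abs_sub_inner_perp_le z t w)
      by_contra! hle
      rw [abs_le] at hle
      exact ht ⟨by linarith [hle.1], by linarith [hle.2]⟩
    rw [← setIntegral_eq_integral_of_forall_compl_eq_zero hz0, ← Real.norm_eq_abs]
    refine (norm_setIntegral_le_of_norm_le_const (C := Real.exp |μ| * a)
      isCompact_Icc.measure_lt_top fun t ht => ?_).trans ?_
    · rw [norm_mul, Real.norm_of_nonneg (Real.exp_pos _).le, Real.norm_eq_abs]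
      refine mul_le_mul ?_ (hb _) (abs_nonneg _) (Real.exp_pos _).le
      -- Here `|t| ≤ ‖w‖ + h / 3 ≤ 1`, so the exponential weight is at most `exp |μ|`.
      refine Real.exp_le_exp.2 ((le_abs_self _).trans ?_)
      rw [abs_mul]
      refine mul_le_of_le_one_right (abs_nonneg _) ?_
      have := abs_le.1 hc
      exact abs_le.2 ⟨by linarith [ht.1], by linarith [ht.2]⟩
    · rw [Real.volume_real_Icc_of_le (by linarith)]
      have : 0 ≤ Real.exp |μ| * a := by positivity
      exact mul_le_mul_of_nonneg_left (by linarith) this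
  · rw [Set.indicator_of_notMem (by exact hz)]
    have : ∀ t, Real.exp (μ * t) * (f₁ (linePoint z t) - f₂ (linePoint z t)) = 0 := by
      intro t
      rw [hd (linePoint z t) ((not_le.1 hz).trans_le (abs_sub_inner_dir_le z t w)), sub_self,
        mul_zero]
    simp [this]

/-- The length of the unit circle. -/
noncomputable def circleLength : ℝ := (volume : Measure Plane).toSphere.real Set.univ

theorem cylinderMeasure_strip_le (w : Plane) {h : ℝ} (hh : 0 < h) :
    cylinderMeasure {z : Cylinder | |(z.2 : ℝ) - inner ℝ w (z.1 : Plane)| ≤ h / 3} ≤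
      ENNReal.ofReal (circleLength * h) := by
  have hm : MeasurableSet {z : Cylinder | |(z.2 : ℝ) - inner ℝ w (z.1 : Plane)| ≤ h / 3} := by
    have hc : Continuous fun z : Cylinder => |(z.2 : ℝ) - inner ℝ w (z.1 : Plane)| := by fun_prop
    exact (isClosed_le hc continuous_const).measurableSet
  have : IsFiniteMeasure ((volume : Measure ℝ).comap (Subtype.val : Set.Icc (-1 : ℝ) 1 → ℝ)) :=
    ⟨by
      rw [(MeasurableEmbedding.subtype_coe measurableSet_Icc).comap_apply, Set.image_univ,
        Subtype.range_coe]
      exact measure_Icc_lt_top⟩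
  rw [cylinderMeasure, Measure.prod_apply hm]
  calc _ ≤ ∫⁻ _ : UnitCircle, ENNReal.ofReal h ∂(volume : Measure Plane).toSphere := by
        refine lintegral_mono fun θ => ?_
        rw [(MeasurableEmbedding.subtype_coe measurableSet_Icc).comap_apply]
        calc _ ≤ volume (Set.Icc (inner ℝ w (θ : Plane) - h / 3)
            (inner ℝ w (θ : Plane) + h / 3)) := by
              refine measure_mono ?_
              rintro _ ⟨s, hs, rfl⟩
              have := abs_le.1 (show |(s : ℝ) - inner ℝ w (θ : Plane)| ≤ h / 3 from hs)
              exact ⟨by linarith [this.1], by linarith [this.2]⟩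
          _ ≤ _ := by
              rw [Real.volume_Icc]
              exact ENNReal.ofReal_le_ofReal (by linarith)
    _ = _ := by
        rw [lintegral_const, circleLength, ENNReal.ofReal_mul measureReal_nonneg, mul_comm,
          Measure.real, ENNReal.ofReal_toReal (measure_ne_top _ _)]

/-- With `b` of order `a h`, the strip supplies the further factor `h`, hence the `a² h³` that
determines the rate. -/
theorem lintegral_expRadon_sub_sq_le {μ : ℝ} {f₁ f₂ : Plane → ℝ} {w : Plane} {b h I₀ : ℝ}
    (hh : 0 < h) (hI₀ : 0 ≤ I₀)
    (hb : ∀ z, |expRadon μ f₁ z - expRadon μ f₂ z| ≤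
      {z : Cylinder | |(z.2 : ℝ) - inner ℝ w (z.1 : Plane)| ≤ h / 3}.indicator (fun _ => b) z) :
    ∫⁻ z, ENNReal.ofReal (I₀ * (expRadon μ f₁ z - expRadon μ f₂ z) ^ 2) ∂cylinderMeasure
      ≤ ENNReal.ofReal (I₀ * b ^ 2 * (circleLength * h)) := by
  set S := {z : Cylinder | |(z.2 : ℝ) - inner ℝ w (z.1 : Plane)| ≤ h / 3}
  calc _ ≤ ∫⁻ z, S.indicator (fun _ => ENNReal.ofReal (I₀ * b ^ 2)) z ∂cylinderMeasure := by
        refine lintegral_mono fun z => ?_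
        have hz := hb z
        by_cases hzS : z ∈ S
        · rw [Set.indicator_of_mem hzS] at hz ⊢
          refine ENNReal.ofReal_le_ofReal (mul_le_mul_of_nonneg_left ?_ hI₀)
          exact sq_le_sq' (abs_le.1 hz).1 (abs_le.1 hz).2
        · rw [Set.indicator_of_notMem hzS] at hz ⊢
          rw [abs_nonpos_iff.1 hz]
          simp
    _ ≤ ENNReal.ofReal (I₀ * b ^ 2) * cylinderMeasure S := lintegral_indicator_const_le _ _
    _ ≤ ENNReal.ofReal (I₀ * b ^ 2) * ENNReal.ofReal (circleLength * h) := by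
        gcongr
        exact cylinderMeasure_strip_le w hh
    _ = _ := (ENNReal.ofReal_mul (by positivity)).symm

/-! ### Assouad's argument on the hypercube of bumps -/

/-- The area of the disc on which the bump function equals one. -/
noncomputable def plateauArea : ℝ := volume.real (Metric.closedBall (0 : Plane) (1 / 6))

theorem plateauArea_pos : 0 < plateauArea :=
  ENNReal.toReal_pos (Metric.measure_closedBall_pos _ _ (by norm_num)).ne'
    measure_closedBall_lt_top.ne

theorem volume_plateau (w : Plane) {h : ℝ} (hh : 0 < h) :
    volume (Metric.closedBall w (h / 6)) = ENNReal.ofReal (h ^ 2 * plateauArea) := by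
  have h1 := Measure.addHaar_closedBall_mul (volume : Measure Plane) w hh.le
    (show (0 : ℝ) ≤ 1 / 6 by norm_num)
  rw [finrank_euclideanSpace_fin, show h * (1 / 6) = h / 6 by ring] at h1
  rw [h1, plateauArea, ENNReal.ofReal_mul (by positivity), Measure.real,
    ENNReal.ofReal_toReal measure_closedBall_lt_top.ne]

/-- Amplitudes of the perturbation indexed by a vertex of the hypercube. -/
def amplitude {ι : Type*} (a : ℝ) (ω : ι → Bool) (i : ι) : ℝ := if ω i then a else 0

theorem abs_amplitude_le {ι : Type*} {a : ℝ} (ha : 0 ≤ a) (ω : ι → Bool) (i : ι) :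
    |amplitude a ω i| ≤ a := by
  unfold amplitude
  split_ifs
  · exact (abs_of_nonneg ha).le
  · simpa using ha

/-- The vertex of the hypercube that differs from `ω` at `i` only. -/
def flip {ι : Type*} [DecidableEq ι] (i : ι) (ω : ι → Bool) : ι → Bool :=
  Function.update ω i (!ω i)

theorem flip_involutive {ι : Type*} [DecidableEq ι] (i : ι) : Function.Involutive (flip i) := by
  intro ω
  simp [flip]

theorem amplitude_flip_of_ne {ι : Type*} [DecidableEq ι] (a : ℝ) (ω : ι → Bool) {i j : ι}
    (h : j ≠ i) : amplitude a (flip i ω) j = amplitude a ω j := by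
  simp [amplitude, flip, h]

theorem abs_amplitude_sub_flip {ι : Type*} [DecidableEq ι] {a : ℝ} (ha : 0 ≤ a) (ω : ι → Bool)
    (i : ι) : |amplitude a ω i - amplitude a (flip i ω) i| = a := by
  cases h : ω i <;> simp [amplitude, flip, h, abs_of_nonneg ha]

/-- The squared loss of an estimate on the plateau of the `i`-th bump. -/
noncomputable def localLoss (h : ℝ) (w : Plane) (u f : Plane → ℝ) : ℝ≥0∞ :=
  ∫⁻ x in Metric.closedBall w (h / 6), ENNReal.ofReal ((u x - f x) ^ 2)

theorem sum_localLoss_le {ι : Type*} [Fintype ι] {h : ℝ} {y : ι → Plane} (hy : IsGrid h y)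
    (u f : Plane → ℝ) :
    ∑ i, localLoss h (y i) u f ≤ ∫⁻ x, ENNReal.ofReal ((u x - f x) ^ 2) := by
  unfold localLoss
  rw [← tsum_fintype (L := .unconditional _),
    ← lintegral_iUnion (fun i => Metric.isClosed_closedBall.measurableSet)]
  · exact setLIntegral_le_lintegral _ _
  · intro i j hij
    refine Metric.closedBall_disjoint_closedBall ?_
    linarith [hy.sep i j hij, hy.pos]

theorem measurable_localLoss {n : ℕ} (e : Estimator n) (h : ℝ) (w : Plane) {f : Plane → ℝ}
    (hf : Measurable f) : Measurable fun d => localLoss h w (e.1 d) f := by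
  have hm : Measurable fun p : (Fin n → Cylinder × ℝ) × Plane =>
      ENNReal.ofReal ((Function.uncurry e.1 p - f p.2) ^ 2) := by
    have := e.2
    fun_prop
  exact hm.lintegral_prod_right'

theorem sum_expected_localLoss_le {ι : Type*} [Fintype ι] {h : ℝ} {y : ι → Plane} {μ : ℝ}
    (ν : Measure Cylinder) (G : Measure ℝ) {n : ℕ} (hy : IsGrid h y) (e : Estimator n)
    {f : Plane → ℝ} (hf : Measurable f) :
    ∑ i, ∫⁻ d, localLoss h (y i) (e.1 d) f ∂(dataLaw μ ν G f n) ≤ mise μ ν G e f := by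
  rw [← lintegral_finsetSum _ fun i _ => measurable_localLoss e h (y i) hf]
  exact lintegral_mono fun d => sum_localLoss_le hy _ _

section

variable {ι : Type*} [Fintype ι] [DecidableEq ι] {h a : ℝ} {y : ι → Plane}

theorem bumpSum_sub_flip (ω : ι → Bool) (i : ι) (x : Plane) :
    bumpSum bump h y (amplitude a ω) x - bumpSum bump h y (amplitude a (flip i ω)) x
      = (amplitude a ω i - amplitude a (flip i ω) i) * bump (h⁻¹ • (x - y i)) := by
  unfold bumpSum
  rw [← Finset.sum_sub_distrib, Finset.sum_eq_single i]
  · simp [sub_mul]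
  · intro j _ hj
    rw [amplitude_flip_of_ne a ω hj, sub_self]
  · simp

theorem abs_bumpSum_sub_flip_le (ha : 0 ≤ a) (ω : ι → Bool) (i : ι) (x : Plane) :
    |bumpSum bump h y (amplitude a ω) x - bumpSum bump h y (amplitude a (flip i ω)) x| ≤ a := by
  rw [bumpSum_sub_flip, abs_mul, abs_amplitude_sub_flip ha, abs_of_nonneg bump.nonneg]
  exact mul_le_of_le_one_right ha bump.le_one

theorem bumpSum_eq_flip (hh : 0 < h) (ω : ι → Bool) (i : ι) (x : Plane)
    (hx : h / 3 < dist x (y i)) :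
    bumpSum bump h y (amplitude a ω) x = bumpSum bump h y (amplitude a (flip i ω)) x := by
  rw [← sub_eq_zero, bumpSum_sub_flip]
  refine mul_eq_zero_of_right _ ?_
  by_contra hne
  exact hx.not_ge (dist_le_of_profile_ne_zero support_bump hh hne)

theorem abs_bumpSum_sub_flip_eq (hh : 0 < h) (ha : 0 ≤ a) (ω : ι → Bool) (i : ι) {x : Plane}
    (hx : x ∈ Metric.closedBall (y i) (h / 6)) :
    |bumpSum bump h y (amplitude a ω) x - bumpSum bump h y (amplitude a (flip i ω)) x| = a := by
  rw [bumpSum_sub_flip, bump.one_of_mem_closedBall, mul_one, abs_amplitude_sub_flip ha]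
  rw [Metric.mem_closedBall, dist_eq_norm] at hx
  rw [mem_closedBall_zero_iff, norm_smul, norm_inv, Real.norm_of_nonneg hh.le,
    inv_mul_le_iff₀ hh]
  exact hx.trans (by change h / 6 ≤ h * (1 / 6); linarith)

/-- On the plateau the two functions differ by exactly `a`, and `(u - f₁)² + (u - f₂)² ≥ (f₁ - f₂)²
/ 2`. -/
theorem le_localLoss_add_localLoss (hh : 0 < h) (ha : 0 ≤ a) (ω : ι → Bool) (i : ι)
    {u : Plane → ℝ} (hu : Measurable u) :
    ENNReal.ofReal (a ^ 2 / 2 * (h ^ 2 * plateauArea)) ≤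
      localLoss h (y i) u (bumpSum bump h y (amplitude a ω)) +
      localLoss h (y i) u (bumpSum bump h y (amplitude a (flip i ω))) := by
  have hm := measurable_bumpSum h y (amplitude a ω)
  unfold localLoss
  rw [← lintegral_add_left (by fun_prop), ENNReal.ofReal_mul (by positivity),
    ← volume_plateau (y i) hh, ← setLIntegral_const]
  refine setLIntegral_mono' Metric.isClosed_closedBall.measurableSet fun x hx => ?_
  rw [← ENNReal.ofReal_add (by positivity) (by positivity)]
  refine ENNReal.ofReal_le_ofReal ?_
  have h1 := abs_bumpSum_sub_flip_eq hh ha ω i hx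
  have h2 : (bumpSum bump h y (amplitude a ω) x - bumpSum bump h y (amplitude a (flip i ω)) x) ^ 2
      = a ^ 2 := by rw [← sq_abs, h1]
  nlinarith [sq_nonneg (2 * u x - bumpSum bump h y (amplitude a ω) x
    - bumpSum bump h y (amplitude a (flip i ω)) x)]

theorem le_sum_expected_localLoss {I₀ v₀ C₃ μ : ℝ} (hI₀ : 0 < I₀) (ν : Measure Cylinder)
    (G : Measure ℝ) [IsProbabilityMeasure ν] [IsProbabilityMeasure G]
    (hG : NoiseCondition I₀ v₀ G) (hν : FeasibleDesign C₃ ν) {n : ℕ} (hy : IsGrid h y)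
    (ha : 0 < a) (hv : Real.exp |μ| * a * h ≤ v₀)
    (hE : ENNReal.ofReal C₃ * n *
      ENNReal.ofReal (I₀ * (Real.exp |μ| * a * h) ^ 2 * (circleLength * h))
        ≤ ENNReal.ofReal (1 / 2))
    (e : Estimator n) (ω : ι → Bool) (i : ι) :
    ENNReal.ofReal (a ^ 2 * h ^ 2 * plateauArea / 8) ≤
      ∫⁻ d, localLoss h (y i) (e.1 d) (bumpSum bump h y (amplitude a ω))
        ∂(dataLaw μ ν G (bumpSum bump h y (amplitude a ω)) n) +
      ∫⁻ d, localLoss h (y i) (e.1 d) (bumpSum bump h y (amplitude a (flip i ω)))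
        ∂(dataLaw μ ν G (bumpSum bump h y (amplitude a (flip i ω))) n) := by
  have hh := hy.pos
  have hv0 := plateauArea_pos
  have hm := fun ω => measurable_bumpSum h y (amplitude a ω)
  have hc := fun ω => (contDiff_bumpSum bump.contDiff h y (amplitude a ω)).continuous
  have hs := fun ω => support_bumpSum support_bump hy (amplitude a ω)
  have hR := abs_expRadon_sub_le μ (hc ω) (hc (flip i ω)) (hs ω) (hs (flip i ω)) ha.le hh
    (hy.inside i) (abs_bumpSum_sub_flip_le ha.le ω i) (bumpSum_eq_flip hh ω i)
  set r := a ^ 2 / 2 * (h ^ 2 * plateauArea) with hr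
  have hrpos : 0 < r := by positivity
  have hr0 : ENNReal.ofReal r ≠ 0 := (ENNReal.ofReal_pos.2 hrpos).ne'
  have hl := fun ω => measurable_localLoss e h (y i) (hm ω)
  -- The local losses divided by `r` serve directly as the two testing functions: their sum is at
  -- least one, so no test has to be built from the estimator.
  have key := quarter_le_testing_error hI₀ μ ν G hG hν (hm ω) (hm (flip i ω)) (n := n)
    (fun z => (hR z).trans ((Set.indicator_le_self' (fun _ _ => by positivity) z).trans hv))
    ((mul_le_mul_right (lintegral_expRadon_sub_sq_le hh hI₀.le hR) _).trans hE)
    ((hl ω).const_mul (ENNReal.ofReal r)⁻¹) ((hl (flip i ω)).const_mul (ENNReal.ofReal r)⁻¹)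
    (fun d => by
      rw [← mul_add, ← ENNReal.inv_mul_cancel hr0 ENNReal.ofReal_ne_top]
      gcongr
      exact le_localLoss_add_localLoss hh ha.le ω i (e.2.comp measurable_prodMk_left))
  rw [lintegral_const_mul _ (hl ω), lintegral_const_mul _ (hl (flip i ω)), ← mul_add,
    ← ENNReal.div_eq_inv_mul, ENNReal.le_div_iff_mul_le (Or.inl hr0)
      (Or.inl ENNReal.ofReal_ne_top),
    ← ENNReal.ofReal_mul (by norm_num)] at key
  refine le_trans (ENNReal.ofReal_le_ofReal (le_of_eq ?_)) key
  rw [hr]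
  ring

/-- Assouad's lemma for sums of bumps. -/
theorem card_mul_le_iSup_mise {β L I₀ v₀ C₃ μ : ℝ} (hI₀ : 0 < I₀) (ν : Measure Cylinder)
    (G : Measure ℝ) [IsProbabilityMeasure ν] [IsProbabilityMeasure G]
    (hG : NoiseCondition I₀ v₀ G) (hν : FeasibleDesign C₃ ν) {n : ℕ} (hy : IsGrid h y)
    (ha : 0 < a) (hv : Real.exp |μ| * a * h ≤ v₀)
    (hE : ENNReal.ofReal C₃ * n *
      ENNReal.ofReal (I₀ * (Real.exp |μ| * a * h) ^ 2 * (circleLength * h))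
        ≤ ENNReal.ofReal (1 / 2))
    (hS : ∀ ω : ι → Bool, bumpSum bump h y (amplitude a ω) ∈ sobolevClass β L)
    (e : Estimator n) :
    ENNReal.ofReal (Fintype.card ι * (a ^ 2 * h ^ 2 * plateauArea / 16)) ≤
      ⨆ f ∈ sobolevClass β L, mise μ ν G e f := by
  have hv0 := plateauArea_pos
  set M := ⨆ f ∈ sobolevClass β L, mise μ ν G e f with hM
  set R : (ι → Bool) → ι → ℝ≥0∞ := fun ω i =>
    ∫⁻ d, localLoss h (y i) (e.1 d) (bumpSum bump h y (amplitude a ω))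
        ∂(dataLaw μ ν G (bumpSum bump h y (amplitude a ω)) n) with hR
  set r := ENNReal.ofReal (a ^ 2 * h ^ 2 * plateauArea / 8) with hr
  have hpair : ∀ ω i, r ≤ R ω i + R (flip i ω) i := fun ω i =>
    le_sum_expected_localLoss hI₀ ν G hG hν hy ha hv hE e ω i
  have hsum : ∀ ω, ∑ i, R ω i ≤ M := fun ω =>
    (sum_expected_localLoss_le ν G hy e (measurable_bumpSum h y (amplitude a ω))).trans
      (le_iSup₂_of_le _ (hS ω) le_rfl)
  have hflip : ∀ i, ∑ ω, R (flip i ω) i = ∑ ω, R ω i := fun i =>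
    Equiv.sum_comp (flip_involutive i).toPerm fun ω => R ω i
  set c : ℝ≥0∞ := (Fintype.card (ι → Bool) : ℝ≥0∞) with hc
  have hc0 : c ≠ 0 := by simp [hc]
  have hct : c ≠ ∞ := ENNReal.natCast_ne_top _
  -- Average over all vertices. Flipping permutes them, so each local risk is counted twice, which
  -- gives the factor 2.
  have h1 : c * (Fintype.card ι * r) ≤ c * (2 * M) := by
    calc c * (Fintype.card ι * r) = ∑ i : ι, ∑ _ω : ι → Bool, r := by
          simp only [Finset.sum_const, Finset.card_univ, nsmul_eq_mul]
          ring
      _ ≤ ∑ i : ι, ∑ ω : ι → Bool, (R ω i + R (flip i ω) i) :=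
          Finset.sum_le_sum fun i _ => Finset.sum_le_sum fun ω _ => hpair ω i
      _ = 2 * ∑ ω : ι → Bool, ∑ i : ι, R ω i := by
          simp_rw [Finset.sum_add_distrib, hflip]
          rw [Finset.sum_comm, two_mul]
      _ ≤ 2 * ∑ _ω : ι → Bool, M := by
          gcongr with ω
          exact hsum ω
      _ = c * (2 * M) := by
          simp only [Finset.sum_const, Finset.card_univ, nsmul_eq_mul]
          ring
  have h2 := (ENNReal.mul_le_mul_iff_right hc0 hct).1 h1
  rw [← ENNReal.ofReal_natCast, hr, ← ENNReal.ofReal_mul (by positivity)] at h2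
  have h3 : ENNReal.ofReal (Fintype.card ι * (a ^ 2 * h ^ 2 * plateauArea / 8))
      = 2 * ENNReal.ofReal (Fintype.card ι * (a ^ 2 * h ^ 2 * plateauArea / 16)) := by
    rw [← ENNReal.ofReal_ofNat 2, ← ENNReal.ofReal_mul (by norm_num)]
    congr 1
    norm_num
    ring
  rw [h3] at h2
  exact (ENNReal.mul_le_mul_iff_right two_ne_zero ENNReal.ofNat_ne_top).1 h2

end

/-! ### The lattice of centres and the choice of mesh -/

/-- The points of a square lattice of mesh `h`. -/
noncomputable def gridPoint (h : ℝ) (N : ℕ) (k : Fin N × Fin N) : Plane :=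
  !₂[h * (k.1 : ℕ), h * (k.2 : ℕ)]

theorem isGrid_gridPoint {h : ℝ} {N : ℕ} (hh : 0 < h) (hN : N * h ≤ 1 / 2) :
    IsGrid h (gridPoint h N) where
  pos := hh
  sep i j hij := by
    have hcoord : ∀ l : Fin 2, |gridPoint h N i l - gridPoint h N j l| ≤
        dist (gridPoint h N i) (gridPoint h N j) := fun l => by
      rw [dist_eq_norm]
      exact PiLp.norm_apply_le (gridPoint h N i - gridPoint h N j) l
    have hstep : ∀ m k : Fin N, m ≠ k → h ≤ |h * (m : ℕ) - h * (k : ℕ)| := by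
      intro m k hmk
      have h1 : (1 : ℝ) ≤ |((m : ℕ) : ℝ) - (k : ℕ)| := by
        have h2 : ((m : ℕ) : ℤ) - (k : ℕ) ≠ 0 := by
          rw [sub_ne_zero]
          exact_mod_cast fun h => hmk (Fin.ext h)
        exact_mod_cast Int.one_le_abs h2
      rw [← mul_sub, abs_mul, abs_of_pos hh]
      exact le_mul_of_one_le_right hh.le h1
    by_cases h0 : i.1 = j.1
    · have h1 : i.2 ≠ j.2 := fun h1 => hij (Prod.ext h0 h1)
      exact (hstep _ _ h1).trans (hcoord 1)
    · exact (hstep _ _ h0).trans (hcoord 0)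
  inside k := by
    have hb : ∀ m : Fin N, h * (m : ℕ) ≤ 1 / 2 - h := by
      intro m
      have : ((m : ℕ) : ℝ) + 1 ≤ N := by exact_mod_cast m.2
      nlinarith
    have h1 := hb k.1
    have h2 := hb k.2
    have h3 : 0 ≤ h * ((k.1 : ℕ) : ℝ) := by positivity
    have h4 : 0 ≤ h * ((k.2 : ℕ) : ℝ) := by positivity
    -- Both coordinates lie in `[0, 1 / 2 - h]`, and `2 (1 / 2 - h)² ≤ (1 - h)²` because `h ≤ 1 /
    -- 2`.
    have h5 : ‖gridPoint h N k‖ ≤ 1 - h := by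
      refine le_of_sq_le_sq ?_ (by linarith)
      rw [EuclideanSpace.norm_sq_eq, Fin.sum_univ_two]
      simp only [gridPoint, Real.norm_eq_abs, sq_abs]
      change (h * ((k.1 : ℕ) : ℝ)) ^ 2 + (h * ((k.2 : ℕ) : ℝ)) ^ 2 ≤ _
      nlinarith
    linarith

theorem exists_grid_size {h : ℝ} (hh : 0 < h) (hh1 : h ≤ 1 / 4) :
    ∃ N : ℕ, N * h ≤ 1 / 2 ∧ 1 / 4 ≤ N * h := by
  refine ⟨⌊1 / 2 / h⌋₊, ?_, ?_⟩
  · rw [← le_div_iff₀ hh]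
    exact Nat.floor_le (by positivity)
  · have h1 := Nat.lt_floor_add_one (1 / 2 / h)
    rw [div_lt_iff₀ hh] at h1
    linarith

/-- The mesh `n^{-1/(2β+3)}`. -/
noncomputable def mesh (β : ℝ) (n : ℕ) : ℝ := (n : ℝ) ^ (-(1 / (2 * β + 3)))

theorem tendsto_mesh {β : ℝ} (hβ : 1 < β) : Tendsto (mesh β) atTop (nhds 0) :=
  (tendsto_rpow_neg_atTop (by positivity)).comp tendsto_natCast_atTop_atTop

theorem mesh_rpow (β : ℝ) (n : ℕ) : mesh β n ^ β = rate β n := by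
  rw [mesh, rate, ← Real.rpow_mul (Nat.cast_nonneg n)]
  congr 1
  ring

/-- The balance `n h^(2β+3) = 1`: the information about one bump stays bounded as `n` grows. -/
theorem mul_rate_sq_mul_mesh_pow {β : ℝ} (hβ : 1 < β) {n : ℕ} (hn : 0 < n) :
    n * (rate β n ^ 2 * mesh β n ^ 3) = 1 := by
  have h0 : (0 : ℝ) < n := by exact_mod_cast hn
  rw [rate, mesh, ← Real.rpow_natCast, ← Real.rpow_natCast, ← Real.rpow_mul h0.le,
    ← Real.rpow_mul h0.le, ← Real.rpow_add h0]
  have : -β / (2 * β + 3) * (2 : ℕ) + -(1 / (2 * β + 3)) * (3 : ℕ) = -1 := by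
    push_cast
    field_simp
    ring
  rw [this, Real.rpow_neg_one, mul_inv_cancel₀ h0.ne']

end ExpRadon

/-! ### Choice of constants and conclusion -/

open ExpRadon in
theorem mainTheorem5 (β L μ I₀ v₀ C₃ : ℝ) (hβ : 1 < β) (hL : 0 < L) (hI₀ : 0 < I₀)
    (hv₀ : 0 < v₀) :
    ∃ c₁ : ℝ, 0 < c₁ ∧
      ∀ (ν : Measure ExpRadon.Cylinder) (G : Measure ℝ),
        IsProbabilityMeasure ν → IsProbabilityMeasure G →
        ExpRadon.IsCenteredNoise G → ExpRadon.NoiseCondition I₀ v₀ G →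
        ExpRadon.FeasibleDesign C₃ ν →
        ENNReal.ofReal c₁ ≤
          liminf (fun n : ℕ =>
            ⨅ e : ExpRadon.Estimator n, ⨆ f ∈ ExpRadon.sobolevClass β L,
              ENNReal.ofReal (ExpRadon.rate β n ^ (-2 : ℤ)) * ExpRadon.mise μ ν G e f) atTop := by
  obtain ⟨C, hC, hSob⟩ := exists_sobolev_bound (by linarith : 0 ≤ β)
  have hlen : 0 ≤ circleLength := measureReal_nonneg
  have hv0 := plateauArea_pos
  set D := |C₃| * (I₀ * Real.exp |μ| ^ 2 * circleLength) with hD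
  have hD0 : 0 ≤ D := by positivity
  -- The first term keeps the bump sums in the Sobolev ball, the second keeps the expected Kullback
  -- distance below `1 / 2`; `D + 1` avoids division by zero.
  set A := Real.sqrt (min (L / C) (1 / (2 * (D + 1)))) with hA
  have hmin : 0 < min (L / C) (1 / (2 * (D + 1))) := lt_min (by positivity) (by positivity)
  have hApos : 0 < A := Real.sqrt_pos.2 hmin
  have hA2 : A ^ 2 = min (L / C) (1 / (2 * (D + 1))) := Real.sq_sqrt hmin.le
  have hCA : C * A ^ 2 ≤ L := by
    have : A ^ 2 ≤ L / C := hA2.trans_le (min_le_left _ _)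
    rwa [le_div_iff₀' hC] at this
  have hDA : D * A ^ 2 ≤ 1 / 2 := by
    have : A ^ 2 ≤ 1 / (2 * (D + 1)) := hA2.trans_le (min_le_right _ _)
    rw [le_div_iff₀ (by positivity)] at this
    nlinarith [sq_nonneg A]
  -- One factor `1 / 16` comes from Assouad's bound, the other from `(N h)² ≥ 1 / 16`.
  refine ⟨A ^ 2 * plateauArea / 256, by positivity, ?_⟩
  intro ν G _ _ _ hG hν
  refine le_liminf_of_le (by isBoundedDefault) ?_
  -- The mesh must be small enough for the lattice to fill a fixed share of the disc, and for the
  -- shifts of the noise to stay within `v₀`.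
  have hb : 0 < min (1 / 4) (v₀ / (Real.exp |μ| * A)) := lt_min (by norm_num) (by positivity)
  filter_upwards [(tendsto_mesh hβ).eventually_le_const hb, eventually_gt_atTop 0] with n hn hn0
  have hn0' : (0 : ℝ) < n := by exact_mod_cast hn0
  set h := mesh β n with hh
  have hpos : 0 < h := Real.rpow_pos_of_pos hn0' _
  have hrate : 0 < rate β n := Real.rpow_pos_of_pos hn0' _
  have h4 : h ≤ 1 / 4 := hn.trans (min_le_left _ _)
  obtain ⟨N, hN, hN'⟩ := exists_grid_size hpos h4
  have hgrid := isGrid_gridPoint hpos hN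
  set a := A * rate β n with ha
  have hapos : 0 < a := by positivity
  have hrate1 : rate β n ≤ 1 := by
    rw [← mesh_rpow]
    exact Real.rpow_le_one hpos.le (by linarith) (by linarith)
  have hv : Real.exp |μ| * a * h ≤ v₀ := by
    have h1 : h ≤ v₀ / (Real.exp |μ| * A) := hn.trans (min_le_right _ _)
    rw [le_div_iff₀' (by positivity)] at h1
    refine le_trans ?_ h1
    gcongr
    exact mul_le_of_le_one_right hApos.le hrate1
  have hE : ENNReal.ofReal C₃ * n *
      ENNReal.ofReal (I₀ * (Real.exp |μ| * a * h) ^ 2 * (circleLength * h))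
        ≤ ENNReal.ofReal (1 / 2) := by
    calc _ ≤ ENNReal.ofReal |C₃| * ENNReal.ofReal n *
          ENNReal.ofReal (I₀ * (Real.exp |μ| * a * h) ^ 2 * (circleLength * h)) := by
          rw [ENNReal.ofReal_natCast]
          gcongr
          exact le_abs_self _
      _ = ENNReal.ofReal (D * A ^ 2 * (n * (rate β n ^ 2 * h ^ 3))) := by
          rw [← ENNReal.ofReal_mul (abs_nonneg _), ← ENNReal.ofReal_mul (by positivity), hD, ha]
          congr 1
          ring
      _ ≤ _ := by
          rw [mul_rate_sq_mul_mesh_pow hβ hn0, mul_one]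
          exact ENNReal.ofReal_le_ofReal hDA
  have hS : ∀ ω : Fin N × Fin N → Bool,
      bumpSum bump h (gridPoint h N) (amplitude a ω) ∈ sobolevClass β L := by
    intro ω
    refine ⟨measurable_bumpSum _ _ _, integrable_bumpSum hgrid _,
      support_bumpSum support_bump hgrid _, ?_⟩
    refine (hSob _ h a _ _ hgrid (by linarith) hapos.le (abs_amplitude_le hapos.le ω)).trans ?_
    refine ENNReal.ofReal_le_ofReal (le_trans (le_of_eq ?_) hCA)
    have h1 : h ^ (-2 * β) * rate β n ^ 2 = 1 := by
      rw [← mesh_rpow, ← Real.rpow_natCast, ← Real.rpow_mul hpos.le, ← Real.rpow_add hpos]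
      rw [show -2 * β + β * (2 : ℕ) = 0 by push_cast; ring, Real.rpow_zero]
    rw [ha]
    linear_combination C * A ^ 2 * h1
  refine le_iInf fun e => ?_
  simp_rw [← ENNReal.mul_iSup]
  refine le_trans ?_ (mul_le_mul_right
    (card_mul_le_iSup_mise hI₀ ν G hG hν hgrid hapos hv hE hS e) _)
  rw [← ENNReal.ofReal_mul (by positivity)]
  refine ENNReal.ofReal_le_ofReal ?_
  have hNN : 1 / 16 ≤ (N * h) ^ 2 := by nlinarith
  rw [Fintype.card_prod, Fintype.card_fin, ha]
  have e1 : rate β n ^ (-2 : ℤ) * (((N * N : ℕ) : ℝ) *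
      ((A * rate β n) ^ 2 * h ^ 2 * plateauArea / 16))
      = A ^ 2 * plateauArea / 16 * (N * h) ^ 2 := by
    have hz : rate β n ^ (-2 : ℤ) = (rate β n ^ 2)⁻¹ := by
      rw [zpow_neg]
      norm_cast
    rw [hz, Nat.cast_mul]
    field_simp
  rw [e1]
  have : 0 ≤ A ^ 2 * plateauArea / 16 := by positivity
  nlinarith
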